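/- Let $X$ be a finite-dimensional real Hilbert space (a Euclidean space). A subset of $X$ is called polyhedral if it is the intersection of finitely many closed halfspaces, a cone if it equals the set of all its strictly positive multiples, and a polyhedral cone if it is both polyhedral and a cone. For a nonempty closed convex set $C\subseteq X$, let $P_C$ denote the map sending each point of $X$ to its unique nearest point in $C$. Let $\mathcal{C}$ be a nonempty finite collection of nonempty polyhedral cones in $X$, let $\lambda\in\,]0,1]$, and let $x^{(0)}\in X$. Let $(x^{(n)})_{n\in\mathbb{N}}$ be any sequence in $X$ generated as follows: given $x^{(n)}$, pick any $$R_n\in\{(1-\mu)\mathrm{Id}+\mu P_C : C\in\mathcal{C},\ \mu\in[\lambda,2-\lambda]\}$$ and set $x^{(n+1)}:=R_n x^{(n)}$. Then $$\sum_{n=0}^{\infty}\|x^{(n+1)}-x^{(n)}\|^{\gamma}<+\infty\quad\text{for all }\gamma>0.$$ -/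

import Mathlib

open scoped Pointwise

namespace RandomProj

variable {X : Type*} [NormedAddCommGroup X] [InnerProductSpace ℝ X]

/-- `H` is a closed halfspace `{x | ⟪a, x⟫ ≤ β}` with `a ≠ 0`. -/
def IsClosedHalfspace (H : Set X) : Prop :=
  ∃ (a : X) (β : ℝ), a ≠ 0 ∧ H = {x | inner ℝ a x ≤ β}

/-- `C` is an intersection of finitely many closed halfspaces
(the empty intersection being the whole space). -/
def IsPolyhedral (C : Set X) : Prop :=
  ∃ 𝓗 : Set (Set X), 𝓗.Finite ∧ (∀ H ∈ 𝓗, IsClosedHalfspace H) ∧ C = ⋂₀ 𝓗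

/-- `C` is a cone if it equals its set of strictly positive multiples. -/
def IsCone (C : Set X) : Prop :=
  Set.Ioi (0 : ℝ) • C = C

/-- A polyhedral cone is a polyhedral set that is a cone. -/
def IsPolyhedralCone (C : Set X) : Prop :=
  IsPolyhedral C ∧ IsCone C

/-- `p` is a nearest point to `x` in `C`. -/
def IsNearestPoint (C : Set X) (x p : X) : Prop :=
  p ∈ C ∧ ∀ y ∈ C, ‖x - p‖ ≤ ‖x - y‖

/-- The projector onto `C`: it maps `x` to its nearest point in `C`, which exists and is
unique when `C` is nonempty, closed and convex (see `projector_eq_iff`). -/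
noncomputable def projector (C : Set X) (x : X) : X :=
  Classical.epsilon fun p => IsNearestPoint C x p

/-- The set of relaxed projectors `(1 - μ) Id + μ P_C`, where `C ∈ 𝓒` and `μ ∈ Λ`. -/
def relaxedProjectors (𝓒 : Set (Set X)) (Λ : Set ℝ) : Set (X → X) :=
  {R | ∃ C ∈ 𝓒, ∃ μ ∈ Λ, R = fun x => (1 - μ) • x + μ • projector C x}

theorem IsPolyhedral.isClosed {C : Set X} (hC : IsPolyhedral C) : IsClosed C := by
  obtain ⟨𝓗, -, h, rfl⟩ := hC
  refine isClosed_sInter fun H hH => ?_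
  obtain ⟨a, β, -, rfl⟩ := h H hH
  exact isClosed_le (by fun_prop) continuous_const

theorem IsPolyhedral.convex {C : Set X} (hC : IsPolyhedral C) : Convex ℝ C := by
  obtain ⟨𝓗, -, h, rfl⟩ := hC
  refine convex_sInter fun H hH => ?_
  obtain ⟨a, β, -, rfl⟩ := h H hH
  exact convex_halfSpace_le (innerₛₗ ℝ a).isLinear β

theorem isNearestPoint_iff {C : Set X} (hc : Convex ℝ C) {x p : X} :
    IsNearestPoint C x p ↔ p ∈ C ∧ ∀ y ∈ C, inner ℝ (x - p) (y - p) ≤ 0 := by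
  refine and_congr_right fun hp => ?_
  rw [← norm_eq_iInf_iff_real_inner_le_zero hc hp]
  have : Nonempty C := ⟨⟨p, hp⟩⟩
  have hb : BddBelow (Set.range fun w : C => ‖x - w‖) :=
    ⟨0, by rintro _ ⟨w, rfl⟩; exact norm_nonneg _⟩
  constructor
  · intro h
    exact le_antisymm (le_ciInf fun w => h w w.2) (ciInf_le hb ⟨p, hp⟩)
  · intro h y hy
    rw [h]
    exact ciInf_le hb ⟨y, hy⟩

/-- For a nonempty closed convex set, the projector is the unique nearest point. -/
theorem projector_eq_iff [CompleteSpace X] {C : Set X} (hne : C.Nonempty) (hcl : IsClosed C)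
    (hc : Convex ℝ C) {x p : X} : projector C x = p ↔ IsNearestPoint C x p := by
  have hex : ∃ q, IsNearestPoint C x q := by
    obtain ⟨q, hq, h⟩ := exists_norm_eq_iInf_of_complete_convex hne hcl.isComplete hc x
    exact ⟨q, (isNearestPoint_iff hc).2
      ⟨hq, (norm_eq_iInf_iff_real_inner_le_zero hc hq).1 h⟩⟩
  have hspec : IsNearestPoint C x (projector C x) := Classical.epsilon_spec hex
  refine ⟨fun h => h ▸ hspec, fun h => ?_⟩
  obtain ⟨h1, h1'⟩ := (isNearestPoint_iff hc).1 hspec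
  obtain ⟨h2, h2'⟩ := (isNearestPoint_iff hc).1 h
  have e1 := h1' p h2
  have e2 := h2' _ h1
  set q := projector C x
  have key : inner ℝ (q - p) (q - p) ≤ 0 := by
    have : inner ℝ (q - p) (q - p) = inner ℝ (x - q) (p - q) + inner ℝ (x - p) (q - p) := by
      simp only [inner_sub_left, inner_sub_right, real_inner_comm]
      ring
    linarith
  rw [real_inner_self_nonpos] at key
  exact sub_eq_zero.1 key

end RandomProj

/-! At a given point, the projector onto a polyhedral cone acts as the orthogonal projector onto the
subspace cut out by the active constraints, and only finitely many active sets exist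
(`exists_finite_projector_eq`). It therefore suffices to treat relaxed projections onto a finite
family of subspaces, used in any order.

For these, the `γ`-th power sum is at most `K * ‖x 0‖ ^ γ`, with `K` independent of the order and of
the length (`exists_sum_norm_rpow_le`), by induction on the family. Let `M` be its intersection;
after subtracting a point of `M`, the orbit lives in `Mᗮ`. Cut it when the last missing subspace
first appears: the steps before that use a smaller family, the step itself has norm at most `2 * ‖x
0‖`, and by then the norm has shrunk by a fixed factor `q < 1` (`exists_decrease_of_covering`).
Repeating gives a geometric series. Waiting arbitrarily long for the missing subspace costs nothing
extra, since the bound for the smaller family is uniform in length. -/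

namespace RandomProj

open Finset

/-! ### Relaxed projections onto subspaces: norm decrease and regularity -/

section Subspaces

variable {X : Type*} [NormedAddCommGroup X] [InnerProductSpace ℝ X] [FiniteDimensional ℝ X]

/-- The first `N` steps of `x` are relaxed projections onto the subspaces `L 0, L 1, …`, with
relaxation parameters in `[lam, 2 - lam]`. -/
def IsRelaxedOrbit (lam : ℝ) (L : ℕ → Submodule ℝ X) (x : ℕ → X) (N : ℕ) : Prop :=
  ∀ n < N, ∃ μ ∈ Set.Icc lam (2 - lam),
    x (n + 1) = (1 - μ) • x n + μ • (L n).starProjection (x n)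

theorem IsRelaxedOrbit.mono {lam : ℝ} {L : ℕ → Submodule ℝ X} {x : ℕ → X} {M N : ℕ}
    (h : IsRelaxedOrbit lam L x N) (hMN : M ≤ N) : IsRelaxedOrbit lam L x M :=
  fun n hn => h n (hn.trans_le hMN)

theorem IsRelaxedOrbit.shift {lam : ℝ} {L : ℕ → Submodule ℝ X} {x : ℕ → X} {M N : ℕ}
    (h : IsRelaxedOrbit lam L x (M + N)) :
    IsRelaxedOrbit lam (fun n => L (M + n)) (fun n => x (M + n)) N :=
  fun n hn => h (M + n) (by omega)

theorem IsRelaxedOrbit.sub_const {lam : ℝ} {L : ℕ → Submodule ℝ X} {x : ℕ → X} {N : ℕ}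
    (h : IsRelaxedOrbit lam L x N) {p : X} (hp : ∀ n < N, p ∈ L n) :
    IsRelaxedOrbit lam L (fun n => x n - p) N := by
  intro n hn
  obtain ⟨μ, hμ, hx⟩ := h n hn
  refine ⟨μ, hμ, ?_⟩
  simp only [hx, map_sub, Submodule.starProjection_eq_self_iff.2 (hp n hn)]
  module

theorem norm_sq_relaxed (L : Submodule ℝ X) (μ : ℝ) (x : X) :
    ‖(1 - μ) • x + μ • L.starProjection x‖ ^ 2
      = ‖x‖ ^ 2 - μ * (2 - μ) * ‖x - L.starProjection x‖ ^ 2 := by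
  have h0 : inner ℝ (x - L.starProjection x) (L.starProjection x) = 0 :=
    Submodule.starProjection_inner_eq_zero x _ (Submodule.starProjection_apply_mem L x)
  have e1 : (1 - μ) • x + μ • L.starProjection x
      = (1 - μ) • (x - L.starProjection x) + L.starProjection x := by module
  have e2 : ‖x‖ ^ 2 = ‖x - L.starProjection x‖ ^ 2 + ‖L.starProjection x‖ ^ 2 := by
    conv_lhs => rw [← sub_add_cancel x (L.starProjection x)]
    rw [norm_add_sq_real, h0]; ring
  rw [e1, norm_add_sq_real, inner_smul_left, h0, e2, norm_smul, mul_pow, Real.norm_eq_abs, sq_abs]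
  simp only [mul_zero]
  ring

theorem IsRelaxedOrbit.step_le {lam : ℝ} (hlam : 0 < lam) {L : ℕ → Submodule ℝ X} {x : ℕ → X}
    {N : ℕ} (h : IsRelaxedOrbit lam L x N) {n : ℕ} (hn : n < N) :
    lam ^ 2 * ‖x n - (L n).starProjection (x n)‖ ^ 2 ≤ ‖x n‖ ^ 2 - ‖x (n + 1)‖ ^ 2 := by
  obtain ⟨μ, hμ, hx⟩ := h n hn
  rw [hx, norm_sq_relaxed]
  -- Both `μ` and `2 - μ` are at least `lam`.
  have : lam ^ 2 ≤ μ * (2 - μ) := by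
    rw [sq]
    exact mul_le_mul hμ.1 (by linarith [hμ.2]) hlam.le (by linarith [hμ.1])
  have := mul_le_mul_of_nonneg_right this (sq_nonneg ‖x n - (L n).starProjection (x n)‖)
  linarith

theorem IsRelaxedOrbit.norm_le {lam : ℝ} (hlam : 0 < lam) {L : ℕ → Submodule ℝ X} {x : ℕ → X}
    {N : ℕ} (h : IsRelaxedOrbit lam L x N) {n : ℕ} (hn : n ≤ N) : ‖x n‖ ≤ ‖x 0‖ := by
  induction n with
  | zero => rfl
  | succ n ih =>
    refine le_trans ?_ (ih (by omega))
    have := h.step_le hlam (n := n) (by omega)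
    have h2 : 0 ≤ lam ^ 2 * ‖x n - (L n).starProjection (x n)‖ ^ 2 := by positivity
    exact le_of_sq_le_sq (by linarith) (norm_nonneg _)

/-- Linear regularity of a pair of subspaces. -/
theorem exists_norm_sub_starProjection_inf_le (U V : Submodule ℝ X) :
    ∃ c : ℝ, 0 < c ∧ ∀ x : X, ‖x - (U ⊓ V).starProjection x‖
      ≤ c * (‖x - U.starProjection x‖ + ‖x - V.starProjection x‖) := by
  let Q : X →ₗ[ℝ] X × X :=
    (LinearMap.id - U.starProjection.toLinearMap).prod
      (LinearMap.id - V.starProjection.toLinearMap)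
  have hQ : ∀ x, Q x = (x - U.starProjection x, x - V.starProjection x) := fun x => rfl
  -- An injective linear map on a finite-dimensional space is bounded below; this yields the
  -- constant.
  have hker : LinearMap.ker (Q.domRestrict (U ⊓ V)ᗮ) = ⊥ := by
    rw [LinearMap.ker_eq_bot']
    rintro ⟨y, hy⟩ h
    rw [LinearMap.domRestrict_apply, hQ, Prod.mk_eq_zero, sub_eq_zero, sub_eq_zero] at h
    have hU : y ∈ U := Submodule.starProjection_eq_self_iff.1 h.1.symm
    have hV : y ∈ V := Submodule.starProjection_eq_self_iff.1 h.2.symm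
    have : y ∈ (U ⊓ V) ⊓ (U ⊓ V)ᗮ := ⟨⟨hU, hV⟩, hy⟩
    rw [Submodule.inf_orthogonal_eq_bot, Submodule.mem_bot] at this
    exact Subtype.ext this
  obtain ⟨K, hK, hanti⟩ := LinearMap.exists_antilipschitzWith _ hker
  refine ⟨K, by exact_mod_cast hK, fun x => ?_⟩
  set p := (U ⊓ V).starProjection x with hp
  have hpm : p ∈ U ⊓ V := Submodule.starProjection_apply_mem _ x
  have hmem : x - p ∈ (U ⊓ V)ᗮ := Submodule.sub_starProjection_mem_orthogonal x
  have h1 := hanti.le_mul_norm_sub ⟨x - p, hmem⟩ 0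
  rw [map_zero, neg_add_eq_sub, zero_sub, norm_neg, neg_add_eq_sub, zero_sub, norm_neg,
    LinearMap.domRestrict_apply, hQ] at h1
  have e : (x - p - U.starProjection (x - p), x - p - V.starProjection (x - p))
      = (x - U.starProjection x, x - V.starProjection x) := by
    rw [map_sub, map_sub, Submodule.starProjection_eq_self_iff.2 hpm.1,
      Submodule.starProjection_eq_self_iff.2 hpm.2, sub_sub_sub_cancel_right,
      sub_sub_sub_cancel_right]
  simp only [e] at h1
  refine (show ‖x - p‖ ≤ _ from h1).trans (mul_le_mul_of_nonneg_left ?_ K.2)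
  exact max_le (le_add_of_nonneg_right (norm_nonneg _)) (le_add_of_nonneg_left (norm_nonneg _))

theorem norm_sub_starProjection_le (L : Submodule ℝ X) (x : X) {y : X} (hy : y ∈ L) :
    ‖x - L.starProjection x‖ ≤ ‖x - y‖ := by
  rw [Submodule.starProjection_minimal]
  exact ciInf_le ⟨0, by rintro _ ⟨w, rfl⟩; exact norm_nonneg _⟩ (⟨y, hy⟩ : L)

/-- A sequence that takes all the values in `s` has a time at which it takes the last value of `s`
still missing. -/
theorem exists_last_new_value {ι : Type*} {s : Finset ι} (hs : s.Nonempty) {L : ℕ → ι} {N : ℕ}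
    (hcov : ∀ S ∈ s, ∃ n < N, L n = S) :
    ∃ m < N, (∀ n < m, L n ≠ L m) ∧ L m ∈ s ∧ ∀ S ∈ s, S ≠ L m → ∃ n < m, L n = S := by
  classical
  have hex : ∃ m, ∀ S ∈ s, ∃ n < m, L n = S := ⟨N, hcov⟩
  have hspec := Nat.find_spec hex
  have hle : Nat.find hex ≤ N := Nat.find_min' hex hcov
  obtain ⟨m, hm⟩ : ∃ m, Nat.find hex = m + 1 := by
    refine Nat.exists_eq_succ_of_ne_zero fun h0 => ?_
    obtain ⟨S, hS⟩ := hs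
    obtain ⟨n, hn, -⟩ := hspec S hS
    omega
  have hmin := Nat.find_min hex (m := m) (by omega)
  push Not at hmin
  obtain ⟨S, hS, hSn⟩ := hmin
  rw [hm] at hspec
  have hSm : L m = S := by
    obtain ⟨n, hn, h⟩ := hspec S hS
    rcases Nat.lt_succ_iff_lt_or_eq.1 hn with h' | rfl
    · exact absurd h (hSn n h')
    · exact h
  subst hSm
  refine ⟨m, by omega, hSn, hS, fun T hT hne => ?_⟩
  obtain ⟨n, hn, h⟩ := hspec T hT
  rcases Nat.lt_succ_iff_lt_or_eq.1 hn with h' | rfl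
  · exact ⟨n, h', h⟩
  · exact absurd h.symm hne

/-- Makes constants uniform over the finitely many choices of the last subspace. -/
theorem exists_pos_forall_mem {ι : Type*} {s : Finset ι} {P : ι → ℝ → Prop}
    (hP : ∀ i ε ε', 0 < ε' → ε' ≤ ε → P i ε → P i ε') (h : ∀ i ∈ s, ∃ ε, 0 < ε ∧ P i ε) :
    ∃ ε, 0 < ε ∧ ∀ i ∈ s, P i ε := by
  classical
  induction s using Finset.induction_on with
  | empty => exact ⟨1, one_pos, by simp⟩
  | insert a s _ ih =>
    obtain ⟨ε, hε, h1⟩ := ih fun i hi => h i (mem_insert_of_mem hi)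
    obtain ⟨δ, hδ, h2⟩ := h a (mem_insert_self a s)
    refine ⟨min ε δ, lt_min hε hδ, fun i hi => ?_⟩
    rcases mem_insert.1 hi with rfl | hi
    · exact hP _ _ _ (lt_min hε hδ) (min_le_right _ _) h2
    · exact hP _ _ _ (lt_min hε hδ) (min_le_left _ _) (h1 i hi)

/-- One more projection, onto a new subspace, keeps the norm decrease comparable with the squared
distance to the common intersection. -/
theorem exists_decrease_of_new_subspace {lam : ℝ} (hlam : 0 < lam) (M S : Submodule ℝ X)
    {δ : ℝ} (hδ : 0 < δ) :
    ∃ ε : ℝ, 0 < ε ∧ ∀ (L : ℕ → Submodule ℝ X) (x : ℕ → X) (m : ℕ),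
      IsRelaxedOrbit lam L x (m + 1) → (∀ n < m, M ≤ L n) → L m = S →
      δ * ‖x 0 - M.starProjection (x 0)‖ ^ 2 ≤ ‖x 0‖ ^ 2 - ‖x m‖ ^ 2 →
      ε * ‖x 0 - (M ⊓ S).starProjection (x 0)‖ ^ 2 ≤ ‖x 0‖ ^ 2 - ‖x (m + 1)‖ ^ 2 := by
  obtain ⟨c, hc, hreg⟩ := exists_norm_sub_starProjection_inf_le M S
  set α := min δ (lam ^ 2)
  have hα : 0 < α := lt_min hδ (by positivity)
  refine ⟨α / (18 * c ^ 2), by positivity, fun L x m hx hM hS hdec => ?_⟩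
  set p := M.starProjection (x 0)
  have hpM : p ∈ M := Submodule.starProjection_apply_mem _ _
  have hstep := hx.step_le hlam (Nat.lt_succ_self m)
  rw [hS] at hstep
  -- Fejér monotonicity: `p` lies in every subspace used before time `m`.
  have hfej : ‖x m - p‖ ≤ ‖x 0 - p‖ :=
    ((hx.mono (Nat.le_succ m)).sub_const fun n hn => hM n hn hpM).norm_le hlam le_rfl
  set b := ‖x 0 - p‖
  set d := ‖x m - S.starProjection (x m)‖
  have hmove : ‖x 0 - x m‖ ≤ 2 * b := by
    have := norm_sub_le_norm_sub_add_norm_sub (x 0) p (x m)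
    rw [norm_sub_rev p (x m)] at this
    linarith
  have hS0 : ‖x 0 - S.starProjection (x 0)‖ ≤ 2 * b + d :=
    (norm_sub_starProjection_le S (x 0) (Submodule.starProjection_apply_mem S (x m))).trans
      ((norm_sub_le_norm_sub_add_norm_sub _ (x m) _).trans (by linarith))
  have hD : ‖x 0 - (M ⊓ S).starProjection (x 0)‖ ≤ c * (3 * b + d) :=
    (hreg (x 0)).trans (mul_le_mul_of_nonneg_left (by linarith) hc.le)
  -- `(3b + d)² ≤ 2(9b² + d²) ≤ 18(b² + d²)`.
  have hD2 : ‖x 0 - (M ⊓ S).starProjection (x 0)‖ ^ 2 ≤ c ^ 2 * (18 * (b ^ 2 + d ^ 2)) := by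
    refine (pow_le_pow_left₀ (norm_nonneg _) hD 2).trans ?_
    rw [mul_pow]
    refine mul_le_mul_of_nonneg_left ?_ (sq_nonneg c)
    nlinarith [sq_nonneg (3 * b - d), sq_nonneg d]
  have h1 : α * b ^ 2 ≤ δ * b ^ 2 := mul_le_mul_of_nonneg_right (min_le_left _ _) (sq_nonneg b)
  have h2 : α * d ^ 2 ≤ lam ^ 2 * d ^ 2 :=
    mul_le_mul_of_nonneg_right (min_le_right _ _) (sq_nonneg d)
  calc α / (18 * c ^ 2) * ‖x 0 - (M ⊓ S).starProjection (x 0)‖ ^ 2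
      ≤ α / (18 * c ^ 2) * (c ^ 2 * (18 * (b ^ 2 + d ^ 2))) :=
        mul_le_mul_of_nonneg_left hD2 (by positivity)
    _ = α * (b ^ 2 + d ^ 2) := by field_simp
    _ ≤ _ := by linarith

/-- An orbit that uses every subspace of a finite family decreases the squared norm by at least a
fixed multiple of the squared distance to the intersection. -/
theorem exists_decrease_of_covering {lam : ℝ} (hlam : 0 < lam) (𝓛 : Finset (Submodule ℝ X)) :
    ∃ ε : ℝ, 0 < ε ∧ ∀ (L : ℕ → Submodule ℝ X) (x : ℕ → X) (N : ℕ),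
      IsRelaxedOrbit lam L x N → (∀ n < N, L n ∈ 𝓛) → (∀ S ∈ 𝓛, ∃ n < N, L n = S) →
      ε * ‖x 0 - (𝓛.inf id).starProjection (x 0)‖ ^ 2 ≤ ‖x 0‖ ^ 2 - ‖x N‖ ^ 2 := by
  classical
  induction 𝓛 using Finset.strongInduction with
  | H 𝓛 ih =>
    rcases 𝓛.eq_empty_or_nonempty with rfl | hne
    · refine ⟨1, one_pos, fun L x N _ hmem _ => ?_⟩
      have hN : N = 0 := by
        by_contra h
        exact absurd (hmem 0 (Nat.pos_of_ne_zero h)) (notMem_empty _)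
      subst hN
      have : (Submodule.starProjection (⊤ : Submodule ℝ X)) (x 0) = x 0 :=
        Submodule.starProjection_eq_self_iff.2 trivial
      simp [this]
    · have key : ∃ ε : ℝ, 0 < ε ∧ ∀ S ∈ 𝓛, ∀ (L : ℕ → Submodule ℝ X) (x : ℕ → X) (m : ℕ),
          IsRelaxedOrbit lam L x (m + 1) → (∀ n < m, L n ∈ 𝓛.erase S) →
          (∀ T ∈ 𝓛.erase S, ∃ n < m, L n = T) → L m = S →
          ε * ‖x 0 - (𝓛.inf id).starProjection (x 0)‖ ^ 2 ≤ ‖x 0‖ ^ 2 - ‖x (m + 1)‖ ^ 2 := by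
        refine exists_pos_forall_mem ?_ fun S hS => ?_
        · intro S ε ε' _ hle h L x m h1 h2 h3 h4
          exact (mul_le_mul_of_nonneg_right hle (sq_nonneg _)).trans (h L x m h1 h2 h3 h4)
        · obtain ⟨δ, hδ, hdec⟩ := ih _ (erase_ssubset hS)
          obtain ⟨ε, hε, h⟩ := exists_decrease_of_new_subspace hlam ((𝓛.erase S).inf id) S hδ
          refine ⟨ε, hε, fun L x m h1 h2 h3 h4 => ?_⟩
          have e : 𝓛.inf id = (𝓛.erase S).inf id ⊓ S := by
            conv_lhs => rw [← insert_erase hS, inf_insert, inf_comm]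
            rfl
          rw [e]
          exact h L x m h1 (fun n hn => Finset.inf_le (f := id) (h2 n hn)) h4
            (hdec L x m (h1.mono (Nat.le_succ m)) h2 h3)
      obtain ⟨ε, hε, h⟩ := key
      refine ⟨ε, hε, fun L x N hx hmem hcov => ?_⟩
      obtain ⟨m, hmN, hnew, hm, hold⟩ := exists_last_new_value hne hcov
      have h1 := h (L m) hm L x m (hx.mono hmN)
        (fun n hn => mem_erase.2 ⟨hnew n hn, hmem n (hn.trans hmN)⟩)
        (fun T hT => hold T (mem_of_mem_erase hT) (ne_of_mem_erase hT)) rfl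
      obtain ⟨k, rfl⟩ := Nat.exists_eq_add_of_le (Nat.succ_le_of_lt hmN)
      have h2 : ‖x (m + 1 + k)‖ ≤ ‖x (m + 1)‖ := hx.shift.norm_le hlam le_rfl
      have := pow_le_pow_left₀ (norm_nonneg _) h2 2
      simp only [Nat.succ_eq_add_one]
      linarith

theorem starProjection_mem_orthogonal_of_le {U L : Submodule ℝ X} (hUL : U ≤ L) {x : X}
    (hx : x ∈ Uᗮ) : L.starProjection x ∈ Uᗮ := by
  intro u hu
  have h := Submodule.sub_starProjection_mem_orthogonal (K := L) x u (hUL hu)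
  rw [inner_sub_right, hx u hu] at h
  linarith

theorem IsRelaxedOrbit.mem_orthogonal {lam : ℝ} {L : ℕ → Submodule ℝ X} {x : ℕ → X} {N : ℕ}
    (h : IsRelaxedOrbit lam L x N) {U : Submodule ℝ X} (hU : ∀ n < N, U ≤ L n)
    (h0 : x 0 ∈ Uᗮ) {n : ℕ} (hn : n ≤ N) : x n ∈ Uᗮ := by
  induction n with
  | zero => exact h0
  | succ n ih =>
    have hxn := ih (by omega)
    obtain ⟨μ, -, hx⟩ := h n hn
    rw [hx]
    exact add_mem (Submodule.smul_mem _ _ hxn)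
      (Submodule.smul_mem _ _ (starProjection_mem_orthogonal_of_le (hU n hn) hxn))

/-! ### Uniform power-sum bound -/

/-- The displacements of relaxed projections onto finitely many subspaces have uniformly bounded
`γ`-th power sums. -/
theorem exists_sum_norm_rpow_le {lam : ℝ} (hlam : 0 < lam) {γ : ℝ} (hγ : 0 < γ)
    (𝓛 : Finset (Submodule ℝ X)) :
    ∃ K : ℝ, 0 < K ∧ ∀ (L : ℕ → Submodule ℝ X) (x : ℕ → X) (N : ℕ),
      IsRelaxedOrbit lam L x N → (∀ n < N, L n ∈ 𝓛) →
      ∑ n ∈ range N, ‖x (n + 1) - x n‖ ^ γ ≤ K * ‖x 0‖ ^ γ := by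
  classical
  induction 𝓛 using Finset.strongInduction with
  | H 𝓛 ih =>
    -- The bound is written as `δ⁻¹` so that it survives shrinking `δ`, as `exists_pos_forall_mem`
    -- requires.
    obtain ⟨δ, hδ, hK'⟩ : ∃ δ : ℝ, 0 < δ ∧ ∀ S ∈ 𝓛, ∀ (L : ℕ → Submodule ℝ X) (x : ℕ → X) (N : ℕ),
        IsRelaxedOrbit lam L x N → (∀ n < N, L n ∈ 𝓛.erase S) →
        ∑ n ∈ range N, ‖x (n + 1) - x n‖ ^ γ ≤ δ⁻¹ * ‖x 0‖ ^ γ := by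
      refine exists_pos_forall_mem ?_ fun S hS => ?_
      · intro S ε ε' hε' hle h L x N h1 h2
        exact (h L x N h1 h2).trans
          (mul_le_mul_of_nonneg_right (inv_anti₀ hε' hle) (by positivity))
      · obtain ⟨K, hK, h⟩ := ih _ (erase_ssubset hS)
        exact ⟨K⁻¹, inv_pos.2 hK, by simpa only [inv_inv] using h⟩
    obtain ⟨ε, hε, hcontr⟩ := exists_decrease_of_covering hlam 𝓛
    set M := 𝓛.inf id
    -- The `max` covers `ε > 1`, which is not excluded (for instance when `M = ⊤`).
    set q : ℝ := Real.sqrt (max 0 (1 - ε))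
    have hq0 : 0 ≤ q := Real.sqrt_nonneg _
    have hq1 : q < 1 := by
      rw [Real.sqrt_lt' one_pos]
      exact max_lt (by norm_num) (by linarith)
    have hqγ : q ^ γ < 1 := Real.rpow_lt_one hq0 hq1 hγ
    -- Solves `K = δ⁻¹ + 2 ^ γ + K * q ^ γ`: early steps, covering step, remainder.
    set K := (δ⁻¹ + 2 ^ γ) / (1 - q ^ γ)
    have hKpos : 0 < K := div_pos (by positivity) (by linarith)
    have hKeq : δ⁻¹ + 2 ^ γ + K * q ^ γ = K := by
      have : K * (1 - q ^ γ) = δ⁻¹ + 2 ^ γ := div_mul_cancel₀ _ (by linarith)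
      linarith
    have hδK : δ⁻¹ ≤ K := by
      have h1 : (0 : ℝ) ≤ 2 ^ γ := by positivity
      have h2 : 0 ≤ K * q ^ γ := by positivity
      linarith
    have main : ∀ (N : ℕ) (L : ℕ → Submodule ℝ X) (x : ℕ → X),
        IsRelaxedOrbit lam L x N → (∀ n < N, L n ∈ 𝓛) → x 0 ∈ Mᗮ →
        ∑ n ∈ range N, ‖x (n + 1) - x n‖ ^ γ ≤ K * ‖x 0‖ ^ γ := by
      intro N
      induction N using Nat.strong_induction_on with
      | _ N ihN =>
      intro L x hx hmem h0
      have hpow : 0 ≤ ‖x 0‖ ^ γ := by positivity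
      by_cases hcov : ∀ S ∈ 𝓛, ∃ n < N, L n = S
      · rcases 𝓛.eq_empty_or_nonempty with h𝓛 | hne
        · have hN : N = 0 := by
            by_contra h
            have := hmem 0 (Nat.pos_of_ne_zero h)
            simp [h𝓛] at this
          subst hN
          simpa using mul_nonneg hKpos.le hpow
        obtain ⟨m, hmN, hnew, hm, hold⟩ := exists_last_new_value hne hcov
        obtain ⟨k, rfl⟩ := Nat.exists_eq_add_of_le (Nat.succ_le_of_lt hmN)
        simp only [Nat.succ_eq_add_one] at *
        have hML : ∀ n < m + 1 + k, M ≤ L n := fun n hn => Finset.inf_le (f := id) (hmem n hn)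
        have s1 := hK' (L m) hm L x m (hx.mono hmN.le)
          fun n hn => mem_erase.2 ⟨hnew n hn, hmem n (hn.trans hmN)⟩
        have s2 : ‖x (m + 1) - x m‖ ^ γ ≤ 2 ^ γ * ‖x 0‖ ^ γ := by
          rw [← Real.mul_rpow (by norm_num) (norm_nonneg _)]
          refine Real.rpow_le_rpow (norm_nonneg _) ?_ hγ.le
          have a1 := hx.norm_le hlam (n := m + 1) (by omega)
          have a2 := hx.norm_le hlam (n := m) (by omega)
          linarith [norm_sub_le (x (m + 1)) (x m)]
        have s3 := ihN k (by omega) (fun n => L (m + 1 + n)) (fun n => x (m + 1 + n)) hx.shift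
          (fun n hn => hmem _ (by omega)) (hx.mem_orthogonal hML h0 (by omega))
        have s4 : ‖x (m + 1)‖ ≤ q * ‖x 0‖ := by
          have hc := hcontr L x (m + 1) (hx.mono (by omega)) (fun n hn => hmem n (by omega))
            fun S hS => by
              by_cases hSm : S = L m
              · exact ⟨m, by omega, hSm.symm⟩
              · obtain ⟨n, hn, h⟩ := hold S hS hSm
                exact ⟨n, by omega, h⟩
          rw [(Submodule.starProjection_apply_eq_zero_iff M).2 h0, sub_zero] at hc
          refine le_of_sq_le_sq ?_ (by positivity)
          rw [mul_pow, Real.sq_sqrt (le_max_left _ _)]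
          have := mul_le_mul_of_nonneg_right (le_max_right 0 (1 - ε)) (sq_nonneg ‖x 0‖)
          linarith
        have s5 : ‖x (m + 1)‖ ^ γ ≤ q ^ γ * ‖x 0‖ ^ γ := by
          rw [← Real.mul_rpow hq0 (norm_nonneg _)]
          exact Real.rpow_le_rpow (norm_nonneg _) s4 hγ.le
        rw [sum_range_add, sum_range_succ]
        have s6 := mul_le_mul_of_nonneg_left s5 hKpos.le
        calc _ ≤ δ⁻¹ * ‖x 0‖ ^ γ + 2 ^ γ * ‖x 0‖ ^ γ + K * (q ^ γ * ‖x 0‖ ^ γ) :=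
              add_le_add (add_le_add s1 s2) (s3.trans s6)
          _ = (δ⁻¹ + 2 ^ γ + K * q ^ γ) * ‖x 0‖ ^ γ := by ring
          _ = K * ‖x 0‖ ^ γ := by rw [hKeq]
      · push Not at hcov
        obtain ⟨S, hS, hSn⟩ := hcov
        exact (hK' S hS L x N hx fun n hn => mem_erase.2 ⟨hSn n hn, hmem n hn⟩).trans
          (mul_le_mul_of_nonneg_right hδK hpow)
    refine ⟨K, hKpos, fun L x N hx hmem => ?_⟩
    set p := M.starProjection (x 0)
    have hp : p ∈ M := Submodule.starProjection_apply_mem _ _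
    have h := main N L (fun n => x n - p)
      (hx.sub_const fun n hn => Finset.inf_le (f := id) (hmem n hn) hp) hmem
      (Submodule.sub_starProjection_mem_orthogonal _)
    simp only [sub_sub_sub_cancel_right] at h
    refine h.trans (mul_le_mul_of_nonneg_left (Real.rpow_le_rpow (norm_nonneg _) ?_ hγ.le) hKpos.le)
    simpa using norm_sub_starProjection_le M (x 0) M.zero_mem

end Subspaces

/-! ### From polyhedral cones to subspaces -/

section Cones

variable {X : Type*} [NormedAddCommGroup X] [InnerProductSpace ℝ X]

theorem IsCone.smul_mem {C : Set X} (hC : IsCone C) {t : ℝ} (ht : 0 < t) {x : X} (hx : x ∈ C) :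
    t • x ∈ C := by
  rw [← hC]
  exact Set.smul_mem_smul ht hx

/-- The projector onto a polyhedral cone agrees at each point with the orthogonal projector onto
one of finitely many subspaces. -/
theorem IsPolyhedralCone.exists_finite_projector_eq [FiniteDimensional ℝ X] {C : Set X}
    (hne : C.Nonempty) (hC : IsPolyhedralCone C) :
    ∃ 𝓢 : Set (Submodule ℝ X), 𝓢.Finite ∧
      ∀ x, ∃ L ∈ 𝓢, projector C x = L.starProjection x := by
  obtain ⟨hpoly, hcone⟩ := hC
  have hcl := hpoly.isClosed
  have hconv := hpoly.convex
  obtain ⟨𝓗, hfin, hhalf, hCeq⟩ := hpoly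
  choose! a β ha0 hH using hhalf
  refine ⟨(fun 𝓐 : Set (Set X) => (Submodule.span ℝ (a '' 𝓐))ᗮ) '' 𝓗.powerset,
    hfin.finite_subsets.image _, fun x => ?_⟩
  have hmemC : ∀ y, y ∈ C ↔ ∀ H ∈ 𝓗, inner ℝ (a H) y ≤ β H := by
    intro y
    rw [hCeq, Set.mem_sInter]
    refine forall₂_congr fun H h => ?_
    conv_lhs => rw [hH H h]
    rfl
  set p := projector C x with hp
  obtain ⟨hpC, hvar⟩ := (isNearestPoint_iff hconv).1 ((projector_eq_iff hne hcl hconv).1 hp.symm)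
  set 𝓐 : Set (Set X) := {H ∈ 𝓗 | inner ℝ (a H) p = β H}
  refine ⟨_, ⟨𝓐, fun H h => h.1, rfl⟩, ?_⟩
  have hmemL : ∀ v, v ∈ (Submodule.span ℝ (a '' 𝓐))ᗮ ↔ ∀ H ∈ 𝓐, inner ℝ (a H) v = 0 := by
    intro v
    constructor
    · exact fun hv H h => hv _ (Submodule.subset_span ⟨H, h, rfl⟩)
    · intro hv u hu
      induction hu using Submodule.span_induction with
      | mem u hu => obtain ⟨H, h, rfl⟩ := hu; exact hv H h
      | zero => exact inner_zero_left _
      | add u w _ _ h1 h2 => rw [inner_add_left, h1, h2, add_zero]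
      | smul t u _ h1 => rw [inner_smul_left, h1, mul_zero]
  symm
  refine Submodule.eq_starProjection_of_mem_of_inner_eq_zero ((hmemL p).2 fun H h => ?_) ?_
  -- For an active constraint, the points `2p` and `p/2` of `C` give `2β ≤ β` and `β/2 ≤ β`, so `β =
  -- 0`.
  · have h2 := (hmemC _).1 (hcone.smul_mem two_pos hpC) H h.1
    have h3 := (hmemC _).1 (hcone.smul_mem (half_pos one_pos) hpC) H h.1
    rw [inner_smul_right, h.2] at h2 h3
    rw [h.2]
    linarith
  -- Moving from `p` along `v` keeps active constraints tight and, for small `t`, inactive ones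
  -- satisfied. The variational inequality then applies to both `v` and `-v`, which forces
  -- orthogonality.
  · have hle : ∀ v ∈ (Submodule.span ℝ (a '' 𝓐))ᗮ, inner ℝ (x - p) v ≤ 0 := by
      intro v hv
      have hev : ∀ᶠ t : ℝ in nhdsWithin 0 (Set.Ioi 0), p + t • v ∈ C := by
        simp only [hmemC]
        rw [Filter.eventually_all_finite hfin]
        intro H h
        by_cases hact : inner ℝ (a H) p = β H
        · refine Filter.Eventually.of_forall fun t => ?_
          rw [inner_add_right, inner_smul_right, (hmemL v).1 hv H ⟨h, hact⟩, hact]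
          simp
        · have hlt : inner ℝ (a H) (p + (0 : ℝ) • v) < β H := by
            rw [zero_smul, add_zero]
            exact lt_of_le_of_ne ((hmemC p).1 hpC H h) hact
          have hcont : Continuous fun t : ℝ => inner ℝ (a H) (p + t • v) := by fun_prop
          exact ((hcont.tendsto 0).eventually_lt_const hlt).filter_mono nhdsWithin_le_nhds
            |>.mono fun t ht => ht.le
      obtain ⟨t, htC, ht⟩ := (hev.and self_mem_nhdsWithin).exists
      have := hvar _ htC
      rw [add_sub_cancel_left, inner_smul_right] at this
      exact nonpos_of_mul_nonpos_right this ht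
    intro v hv
    have h1 := hle v hv
    have h2 := hle (-v) (neg_mem hv)
    rw [inner_neg_right] at h2
    linarith

end Cones

end RandomProj

theorem theoremt {X : Type*} [NormedAddCommGroup X] [InnerProductSpace ℝ X]
    [FiniteDimensional ℝ X]
    (𝓒 : Set (Set X)) (h𝓒_fin : 𝓒.Finite) (h𝓒_ne : 𝓒.Nonempty)
    (h𝓒 : ∀ C ∈ 𝓒, C.Nonempty ∧ RandomProj.IsPolyhedralCone C)
    (lam : ℝ) (hlam : lam ∈ Set.Ioc (0 : ℝ) 1)
    (R : ℕ → X → X)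
    (hR : ∀ n, R n ∈ RandomProj.relaxedProjectors 𝓒 (Set.Icc lam (2 - lam)))
    (x : ℕ → X) (hx : ∀ n, x (n + 1) = R n (x n)) :
    ∀ γ : ℝ, 0 < γ → Summable fun n : ℕ => ‖x (n + 1) - x n‖ ^ γ := by
  intro γ hγ
  choose! 𝓢 h𝓢_fin h𝓢 using fun C hC =>
    (h𝓒 C hC).2.exists_finite_projector_eq (h𝓒 C hC).1
  have hfin : (⋃ C ∈ 𝓒, 𝓢 C).Finite := h𝓒_fin.biUnion h𝓢_fin
  have hstep : ∀ n, ∃ L ∈ ⋃ C ∈ 𝓒, 𝓢 C, ∃ μ ∈ Set.Icc lam (2 - lam),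
      x (n + 1) = (1 - μ) • x n + μ • L.starProjection (x n) := by
    intro n
    obtain ⟨C, hC, μ, hμ, hRn⟩ := hR n
    obtain ⟨L, hL, hproj⟩ := h𝓢 C hC (x n)
    exact ⟨L, Set.mem_biUnion hC hL, μ, hμ, by rw [hx, hRn, ← hproj]⟩
  choose L hL horbit using hstep
  obtain ⟨K, -, hK⟩ := RandomProj.exists_sum_norm_rpow_le hlam.1 hγ hfin.toFinset
  exact summable_of_sum_range_le (fun n => by positivity) fun N =>
    hK L x N (fun n _ => horbit n) fun n _ => hfin.mem_toFinset.2 (hL n)
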